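/- **Theorem 2.** Let $g:\mathbb{C}\to\mathbb{C}$ be an entire function, let $M(r)=\max_{|z|\le r}|g(z)|$, and suppose that its order $$\rho=\limsup_{r\to\infty}\frac{\ln\ln M(r)}{\ln r}$$ satisfies $0<\rho<\infty$. Let $$\tau=\limsup_{r\to\infty}\frac{\ln M(r)}{r^{\rho}}\in[0,\infty]$$ be its type. For $z\in\mathbb{C}$ put $a_n(z)=g^{(n)}(z)/n!$ and $$\tau_0(z)=\frac{1}{e\rho}\limsup_{k\to\infty}\,2k\,|a_{2k}(z)|^{\rho/(2k)},\qquad \tau_1(z)=\frac{1}{e\rho}\limsup_{k\to\infty}\,(2k+1)\,|a_{2k+1}(z)|^{\rho/(2k+1)}.$$ (i) If $\tau<\infty$, then $\tau_0(z)=\tau$ and $\tau_1(z)=\tau$ for almost every $z\in\mathbb{C}$ (with respect to Lebesgue measure). (ii) If $\tau=\infty$, then there exists a dense $G_\delta$ (therefore uncountable) subset $U_\infty$ of $\mathbb{C}$ such that $\tau_0(z)=\infty$ and $\tau_1(z)=\infty$ for all $z\in U_\infty$. -/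

import Mathlib

open Filter MeasureTheory Topology

noncomputable section

namespace EntireType

/-- The maximum modulus `M(r) = sup_{|z| ≤ r} |g(z)|`. -/
def maxModulus (g : ℂ → ℂ) (r : ℝ) : ℝ :=
  sSup ((fun z : ℂ => ‖g z‖) '' Metric.closedBall (0 : ℂ) r)

/-- The order `ρ(g) = limsup_{r → ∞} ln ln M(r) / ln r`, an extended real number. -/
def order (g : ℂ → ℂ) : EReal :=
  limsup (fun r : ℝ =>
    ((Real.log (Real.log (maxModulus g r)) / Real.log r : ℝ) : EReal)) atTop

/-- The order as a real number; meaningful when `order g` is finite. -/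
def rho (g : ℂ → ℂ) : ℝ := (order g).toReal

/-- The type `τ(g) = limsup_{r → ∞} ln M(r) / r ^ ρ`, an extended real number;
meaningful when `0 < ρ < ∞`. -/
def type (g : ℂ → ℂ) : EReal :=
  limsup (fun r : ℝ => ((Real.log (maxModulus g r) / r ^ rho g : ℝ) : EReal)) atTop

/-- The Taylor coefficient `a_n(z) = g⁽ⁿ⁾(z) / n!` of `g` at the point `z`. -/
def coeff (g : ℂ → ℂ) (n : ℕ) (z : ℂ) : ℂ :=
  iteratedDeriv n g z / (n.factorial : ℂ)

/-- `τ₀(z) = (1 / (e ρ)) limsup_k 2k |a_{2k}(z)| ^ (ρ / 2k)`. -/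
def tauEven (g : ℂ → ℂ) (z : ℂ) : EReal :=
  ((1 / (Real.exp 1 * rho g) : ℝ) : EReal) *
    limsup (fun k : ℕ =>
      ((((2 * k : ℕ) : ℝ) * ‖coeff g (2 * k) z‖ ^ (rho g / ((2 * k : ℕ) : ℝ)) : ℝ) : EReal))
      atTop

/-- `τ₁(z) = (1 / (e ρ)) limsup_k (2k+1) |a_{2k+1}(z)| ^ (ρ / (2k+1))`. -/
def tauOdd (g : ℂ → ℂ) (z : ℂ) : EReal :=
  ((1 / (Real.exp 1 * rho g) : ℝ) : EReal) *
    limsup (fun k : ℕ =>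
      ((((2 * k + 1 : ℕ) : ℝ) *
        ‖coeff g (2 * k + 1) z‖ ^ (rho g / ((2 * k + 1 : ℕ) : ℝ)) : ℝ) : EReal))
      atTop

end EntireType

end

noncomputable section

namespace EntireType

/-! Up to an arbitrarily small increase of `σ`, growth `exp (σ |z| ^ ρ)` amounts to `n |aₙ| ^ (ρ /
n) ≤ e ρ σ` for large `n`, because `exp (σ r ^ ρ) / r ^ n` is least at `r ^ ρ = n / (ρ σ)`. Cauchy's
estimate thus bounds both parities by the type. Conversely, coefficients of one parity suffice if
their bound is uniform on a disc: `aₙ₊₁ = aₙ' / (n + 1)`, so Cauchy's estimate for `aₙ` controls the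
missing parity (`hasGrowth_of_scaledCoeff_le`).

For finite type `t`, suppose that the bound with some `σ < t` holds from a fixed index on over a set
of positive measure. The two constants theorem (`norm_le_mul_rpow_volume`, from Jensen's formula and
polar coordinates) propagates it to the whole unit disc, with an exponent `θ` that does not depend
on `n`. The resulting uniform constant is still below `t`, a contradiction
(`volume_boundSet_eq_zero`). For infinite type, no uniform bound can hold on any disc, so the points
with large coefficients form dense open sets, and Baire's theorem applies. -/

/-! ### Elementary estimates for `exp (σ r ^ ρ)`. -/

lemma natCast_mul_rpow_le_iff {n : ℕ} (hn : n ≠ 0) {ρ A s : ℝ} (hρ : 0 < ρ) (hA : 0 ≤ A)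
    (hs : 0 ≤ s) : (n : ℝ) * A ^ (ρ / n) ≤ s ↔ A ≤ (s / n) ^ (n / ρ) := by
  have hn' : (0 : ℝ) < n := by positivity
  rw [mul_comm, ← le_div_iff₀ hn']
  have h : ((s / n) ^ ((n : ℝ) / ρ)) ^ (ρ / n) = s / n := by
    rw [← Real.rpow_mul (by positivity)]
    have : (n : ℝ) / ρ * (ρ / n) = 1 := by field_simp
    rw [this, Real.rpow_one]
  conv_lhs => rw [← h]
  exact Real.rpow_le_rpow_iff hA (by positivity) (by positivity)

/-- This is `e x ≤ exp x` at `x = ρ σ r ^ ρ / n`, raised to the power `n / ρ`. -/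
lemma rpow_mul_pow_le_exp {n : ℕ} (hn : n ≠ 0) {ρ σ r : ℝ} (hρ : 0 < ρ) (hσ : 0 ≤ σ)
    (hr : 0 ≤ r) :
    (Real.exp 1 * ρ * σ / n) ^ ((n : ℝ) / ρ) * r ^ n ≤ Real.exp (σ * r ^ ρ) := by
  have hn' : (0 : ℝ) < n := by positivity
  have h1 : r ^ n = (r ^ ρ) ^ ((n : ℝ) / ρ) := by
    rw [← Real.rpow_mul hr, mul_div_cancel₀ _ hρ.ne', Real.rpow_natCast]
  rw [h1, ← Real.mul_rpow (by positivity) (by positivity)]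
  have h2 : Real.exp (σ * r ^ ρ) = (Real.exp (ρ * σ * r ^ ρ / n)) ^ ((n : ℝ) / ρ) := by
    rw [← Real.exp_mul]
    congr 1
    field_simp
  rw [h2]
  refine Real.rpow_le_rpow (by positivity) ?_ (by positivity)
  have h3 := Real.add_one_le_exp (ρ * σ * r ^ ρ / n - 1)
  rw [Real.exp_sub, le_div_iff₀ (Real.exp_pos 1)] at h3
  calc _ = (ρ * σ * r ^ ρ / n - 1 + 1) * Real.exp 1 := by ring
    _ ≤ _ := h3

/-- Since `(1 + R / r) ^ ρ → 1` and `r ^ ρ → ∞`, any gap between `σ` and `σ'` absorbs both the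
constant and the shift of the radius. -/
lemma eventually_mul_exp_le_exp {ρ σ σ' : ℝ} (hρ : 0 < ρ) (hσ : σ < σ') (C R : ℝ) :
    ∀ᶠ r : ℝ in atTop, C * Real.exp (σ * (r + R) ^ ρ) ≤ Real.exp (σ' * r ^ ρ) := by
  set D := max C 1
  have hD : 0 < D := lt_max_of_lt_right one_pos
  have h1 : Tendsto (fun r : ℝ => 1 + R / r) atTop (𝓝 (1 + 0)) :=
    tendsto_const_nhds.add (tendsto_const_nhds.div_atTop tendsto_id)
  have h2 := (h1.rpow_const (p := ρ) (Or.inl (by norm_num))).const_mul σ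
  have h3 : Tendsto (fun r : ℝ => Real.log D / r ^ ρ) atTop (𝓝 0) :=
    tendsto_const_nhds.div_atTop (tendsto_rpow_atTop hρ)
  have h4 := h2.add h3
  simp only [add_zero, Real.one_rpow, mul_one] at h4
  filter_upwards [h4.eventually_lt_const hσ, eventually_gt_atTop 0, eventually_gt_atTop (-R)]
    with r hr hr0 hrR
  calc C * Real.exp (σ * (r + R) ^ ρ) ≤ D * Real.exp (σ * (r + R) ^ ρ) := by
        gcongr
        exact le_max_left _ _
    _ = Real.exp (Real.log D + σ * (r + R) ^ ρ) := by rw [Real.exp_add, Real.exp_log hD]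
    _ ≤ Real.exp (σ' * r ^ ρ) := by
        have hp : 0 < r ^ ρ := Real.rpow_pos_of_pos hr0 _
        have h5 : (r + R) ^ ρ = (1 + R / r) ^ ρ * r ^ ρ := by
          rw [← Real.mul_rpow _ hr0.le]
          · congr 1
            field_simp
          · have : 1 + R / r = (r + R) / r := by field_simp
            rw [this]
            exact div_nonneg (by linarith) hr0.le
        rw [Real.exp_le_exp, h5]
        have h6 := mul_le_mul_of_nonneg_right hr.le hp.le
        rw [add_mul, div_mul_cancel₀ _ hp.ne'] at h6
        linarith

lemma exists_exp_le_mul_exp {ρ σ σ' R : ℝ} (hρ : 0 < ρ) (hσ0 : 0 ≤ σ) (hσ : σ < σ')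
    (hR : 0 ≤ R) :
    ∃ C, 0 ≤ C ∧ ∀ r : ℝ, 0 ≤ r →
      Real.exp (σ * (r + R) ^ ρ) ≤ C * Real.exp (σ' * r ^ ρ) := by
  obtain ⟨r₀, h⟩ := eventually_atTop.1 (eventually_mul_exp_le_exp hρ hσ 1 R)
  refine ⟨max 1 (Real.exp (σ * (r₀ + R) ^ ρ)), by positivity, fun r hr => ?_⟩
  rcases le_total r₀ r with h1 | h1
  · have := h r h1
    rw [one_mul] at this
    exact this.trans (le_mul_of_one_le_left (Real.exp_pos _).le (le_max_left _ _))
  · calc Real.exp (σ * (r + R) ^ ρ) ≤ Real.exp (σ * (r₀ + R) ^ ρ) := by gcongr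
      _ ≤ max 1 (Real.exp (σ * (r₀ + R) ^ ρ)) * 1 := by rw [mul_one]; exact le_max_right _ _
      _ ≤ _ := by
        gcongr
        have : 0 ≤ σ' := hσ0.trans hσ.le
        exact Real.one_le_exp (by positivity)

lemma pow_le_mul_exp (n : ℕ) {ρ ε : ℝ} (hρ : 0 < ρ) (hε : 0 < ε) :
    ∃ C, 0 ≤ C ∧ ∀ r : ℝ, 0 ≤ r → r ^ n ≤ C * Real.exp (ε * r ^ ρ) := by
  rcases eq_or_ne n 0 with rfl | hn
  · exact ⟨1, zero_le_one, fun r hr => by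
      rw [pow_zero, one_mul]; exact Real.one_le_exp (by positivity)⟩
  · have hpos : 0 < (Real.exp 1 * ρ * ε / n) ^ ((n : ℝ) / ρ) := by positivity
    refine ⟨((Real.exp 1 * ρ * ε / n) ^ ((n : ℝ) / ρ))⁻¹, by positivity, fun r hr => ?_⟩
    rw [inv_mul_eq_div, le_div_iff₀ hpos, mul_comm]
    exact rpow_mul_pow_le_exp hn hρ hε.le hr


/-! ### The two constants theorem on discs. -/

/-- Sub-mean value property of `log ‖f‖` on circles. -/
lemma log_norm_le_circleAverage {f : ℂ → ℂ} (hf : Differentiable ℂ f) {r : ℝ} (hr : 0 < r)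
    (h0 : f 0 ≠ 0) : Real.log ‖f 0‖ ≤ Real.circleAverage (fun z => Real.log ‖f z‖) 0 r := by
  have han : AnalyticOnNhd ℂ f (Metric.closedBall 0 |r|) := fun z _ => hf.analyticAt z
  -- Jensen's formula: the zeros in the disc contribute nonnegative terms.
  rw [AnalyticOnNhd.circleAverage_log_norm hr.ne' han h0]
  refine le_add_of_nonneg_left (finsum_nonneg fun u => ?_)
  by_cases hu : u ∈ Metric.closedBall (0 : ℂ) |r|
  · refine mul_nonneg (mod_cast MeromorphicOn.AnalyticOnNhd.divisor_nonneg han u) ?_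
    rcases eq_or_ne u 0 with rfl | hu0
    · simp
    · rw [Metric.mem_closedBall, dist_zero_right, abs_of_pos hr] at hu
      have : 0 < ‖u‖ := norm_pos_iff.2 hu0
      apply Real.log_nonneg
      rw [zero_sub, norm_neg, ← div_eq_mul_inv, one_le_div this]
      exact hu
  · rw [Function.locallyFinsuppWithin.apply_eq_zero_of_notMem _ hu]
    simp

/-- If `‖f‖ ≤ A` on a circle about `0` and `‖f‖ ≤ 1` on `E`, then the angular measure of `E` on
that circle is controlled by `log (A / ‖f 0‖)`. -/
lemma volume_angle_le {f : ℂ → ℂ} (hf : Differentiable ℂ f) {r A : ℝ} (hr : 0 < r)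
    (h0 : f 0 ≠ 0) (hA : 1 < A) {E : Set ℂ} (hE : MeasurableSet E)
    (hfA : ∀ z, ‖z‖ = r → ‖f z‖ ≤ A) (hfE : ∀ z ∈ E, ‖f z‖ ≤ 1) :
    volume (circleMap 0 r ⁻¹' E ∩ Set.Ioc (-Real.pi) Real.pi) ≤
      ENNReal.ofReal (2 * Real.pi * (Real.log (A / ‖f 0‖) / Real.log A)) := by
  have hA0 : 0 < A := one_pos.trans hA
  have hlogA : 0 < Real.log A := Real.log_pos hA
  set T := circleMap 0 r ⁻¹' E with hT
  have hTm : MeasurableSet T := (continuous_circleMap 0 r).measurable hE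
  have hmero : MeromorphicOn f (Metric.sphere 0 |r|) :=
    fun z _ => (hf.analyticAt z).meromorphicAt
  have hint := hmero.circleIntegrable_log_norm
  have hsub := log_norm_le_circleAverage hf hr h0
  -- The angles are moved to `(-π, π]`, the range used by polar coordinates.
  rw [Real.circleAverage_eq_integral_add (-Real.pi),
    intervalIntegral.integral_comp_add_right
      (fun θ => Real.log ‖f (circleMap 0 r θ)‖)] at hsub
  have e1 : 0 + -Real.pi = -Real.pi := by ring
  have e2 : 2 * Real.pi + -Real.pi = Real.pi := by ring
  rw [e1, e2, smul_eq_mul, inv_mul_eq_div, le_div_iff₀ (by positivity)] at hsub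
  have hle : -Real.pi ≤ Real.pi := by linarith [Real.pi_pos]
  have hint' : IntervalIntegrable (fun θ => Real.log ‖f (circleMap 0 r θ)‖) volume
      (-Real.pi) Real.pi := by
    have hper : Function.Periodic (fun θ => Real.log ‖f (circleMap 0 r θ)‖) (2 * Real.pi) :=
      fun θ => by simp only [periodic_circleMap 0 r θ]
    exact hper.intervalIntegrable₀ (by positivity) hint _ _
  rw [intervalIntegral.integral_of_le hle] at hsub
  have hconst : Integrable (fun _ : ℝ => Real.log A)
      (volume.restrict (Set.Ioc (-Real.pi) Real.pi)) := integrable_const _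
  have hind : Integrable (T.indicator fun _ => Real.log A)
      (volume.restrict (Set.Ioc (-Real.pi) Real.pi)) := hconst.indicator hTm
  -- The majorant is `0` on `T` and `log A` elsewhere. At zeros of `f` the convention `log 0 = 0` is
  -- harmless since `log A > 0`.
  have hmono : ∫ θ in Set.Ioc (-Real.pi) Real.pi, Real.log ‖f (circleMap 0 r θ)‖ ≤
      ∫ θ in Set.Ioc (-Real.pi) Real.pi,
        (Real.log A - T.indicator (fun _ => Real.log A) θ) := by
    refine integral_mono hint'.1 (hconst.sub hind) fun θ => ?_
    by_cases hmem : θ ∈ T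
    · simp only [Set.indicator_of_mem hmem, sub_self]
      exact Real.log_nonpos (norm_nonneg _) (hfE _ hmem)
    · simp only [Set.indicator_of_notMem hmem, sub_zero]
      rcases eq_or_ne (f (circleMap 0 r θ)) 0 with h | h
      · simp [h, hlogA.le]
      · exact Real.log_le_log (norm_pos_iff.2 h) (hfA _ (by simp [abs_of_pos hr]))
  rw [integral_sub hconst hind, integral_indicator hTm,
    setIntegral_const, setIntegral_const, Measure.real, Measure.real,
    Measure.restrict_apply hTm, Real.volume_Ioc, smul_eq_mul,
    smul_eq_mul, ENNReal.toReal_ofReal (by linarith)] at hmono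
  have hfin : volume (T ∩ Set.Ioc (-Real.pi) Real.pi) ≠ ⊤ :=
    measure_ne_top_of_subset Set.inter_subset_right (by simp)
  rw [← ENNReal.ofReal_toReal hfin]
  refine ENNReal.ofReal_le_ofReal ?_
  rw [← mul_div_assoc, le_div_iff₀ hlogA, Real.log_div hA0.ne' (norm_ne_zero_iff.2 h0)]
  linarith

/-- Integration in polar coordinates: the area is at most `∫ κ r dr` over `(0, R]`. -/
lemma volume_le_of_volume_angle_le {E : Set ℂ} (hE : MeasurableSet E) {R κ : ℝ} (hR : 0 ≤ R)
    (hER : E ⊆ Metric.closedBall 0 R)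
    (h : ∀ r, 0 < r → r ≤ R → volume (circleMap 0 r ⁻¹' E ∩ Set.Ioc (-Real.pi) Real.pi) ≤
      ENNReal.ofReal κ) :
    volume E ≤ ENNReal.ofReal (R ^ 2 / 2 * κ) := by
  have hpolar : ∀ p : ℝ × ℝ, Complex.polarCoord.symm p = circleMap 0 p.1 p.2 := fun p => by
    rw [Complex.polarCoord_symm_apply, circleMap, zero_add, Complex.exp_mul_I,
      Complex.ofReal_cos, Complex.ofReal_sin]
  have hcont : Continuous fun p : ℝ × ℝ => circleMap 0 p.1 p.2 := by
    simp only [circleMap]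
    fun_prop
  have hpol := Complex.lintegral_comp_polarCoord_symm (E.indicator 1)
  simp only [hpolar] at hpol
  rw [lintegral_indicator_one hE] at hpol
  rw [← hpol, polarCoord_target, Measure.volume_eq_prod, ← Measure.prod_restrict,
    lintegral_prod _ (by
      refine Measurable.aemeasurable ?_
      exact (measurable_fst.ennreal_ofReal).smul
        ((measurable_one.indicator hE).comp hcont.measurable))]
  have hinner : ∀ r ∈ Set.Ioi (0 : ℝ),
      ∫⁻ θ in Set.Ioo (-Real.pi) Real.pi, ENNReal.ofReal r •
        E.indicator (1 : ℂ → ENNReal) (circleMap 0 r θ) ≤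
      (Set.Ioc 0 R).indicator (fun r => ENNReal.ofReal r * ENNReal.ofReal κ) r := by
    intro r hr
    rw [Set.mem_Ioi] at hr
    have hm : MeasurableSet (circleMap 0 r ⁻¹' E) := (continuous_circleMap 0 r).measurable hE
    have e : ∀ θ, E.indicator (1 : ℂ → ENNReal) (circleMap 0 r θ) =
        (circleMap 0 r ⁻¹' E).indicator 1 θ := fun θ => rfl
    simp only [e, smul_eq_mul]
    rw [lintegral_const_mul _ (measurable_one.indicator hm), lintegral_indicator_one hm,
      Measure.restrict_apply hm]
    rcases le_or_gt r R with hrR | hrR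
    · rw [Set.indicator_of_mem (Set.mem_Ioc.2 ⟨hr, hrR⟩)]
      gcongr
      exact (measure_mono (Set.inter_subset_inter_right _ Set.Ioo_subset_Ioc_self)).trans (h r hr hrR)
    · have : circleMap 0 r ⁻¹' E = ∅ := by
        refine Set.eq_empty_of_forall_notMem fun θ hθ => ?_
        have := hER hθ
        rw [mem_closedBall_zero_iff, norm_circleMap_zero, abs_of_pos hr] at this
        linarith
      simp [this]
  refine (setLIntegral_mono' measurableSet_Ioi hinner).trans ?_
  rw [lintegral_indicator measurableSet_Ioc, Measure.restrict_restrict measurableSet_Ioc,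
    Set.inter_eq_left.2 Set.Ioc_subset_Ioi_self,
    lintegral_mul_const _ ENNReal.measurable_ofReal,
    ← ofReal_integral_eq_lintegral_ofReal
      (f := fun x : ℝ => x) continuous_id.integrableOn_Ioc,
    ← intervalIntegral.integral_of_le hR, integral_id, ENNReal.ofReal_mul (by positivity)]
  · simp
  · exact (ae_restrict_iff' measurableSet_Ioc).2 (ae_of_all _ fun x hx => hx.1.le)

/-- Two constants theorem on discs: a bound by `B` on a subset `E` of the disc of radius `R`
improves a bound by `A` on the disc to a bound by `A * (B / A) ^ θ` at the centre, where `θ` is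
the proportion of the disc occupied by `E`. -/
theorem norm_le_mul_rpow_volume {f : ℂ → ℂ} (hf : Differentiable ℂ f) {c : ℂ} {R A B : ℝ}
    (hR : 0 < R) (hB : 0 < B) (hAB : B < A) {E : Set ℂ} (hE : MeasurableSet E)
    (hER : E ⊆ Metric.closedBall c R) (hfA : ∀ z ∈ Metric.closedBall c R, ‖f z‖ ≤ A)
    (hfB : ∀ z ∈ E, ‖f z‖ ≤ B) :
    ‖f c‖ ≤ A * (B / A) ^ (volume.real E / (Real.pi * R ^ 2)) := by
  have hA : 0 < A := hB.trans hAB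
  rcases eq_or_ne (f c) 0 with h0 | h0
  · rw [h0, norm_zero]; positivity
  set F : ℂ → ℂ := fun z => f (c + z) / B with hF
  set E' : Set ℂ := (fun z => c + z) ⁻¹' E with hE'
  have hFd : Differentiable ℂ F := by
    refine Differentiable.div_const ?_ _
    exact hf.comp (differentiable_id.const_add c)
  have hF0 : F 0 ≠ 0 := by
    simp only [hF, add_zero]
    exact div_ne_zero h0 (by exact_mod_cast hB.ne')
  have hE'm : MeasurableSet E' := (measurable_const_add c) hE
  have hvol : volume E' = volume E := measure_preimage_add _ _ _
  have hnF : ∀ z, ‖F z‖ = ‖f (c + z)‖ / B := fun z => by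
    simp [hF, abs_of_pos hB]
  have hAB1 : 1 < A / B := (one_lt_div hB).2 hAB
  have hE'R : E' ⊆ Metric.closedBall 0 R := fun z hz => by
    have := hER hz
    rw [mem_closedBall_iff_norm, add_sub_cancel_left] at this
    rwa [mem_closedBall_zero_iff]
  have hFA : ∀ z, ‖z‖ ≤ R → ‖F z‖ ≤ A / B := fun z hz => by
    rw [hnF]
    gcongr
    exact hfA _ (by rwa [mem_closedBall_iff_norm, add_sub_cancel_left])
  have hFE : ∀ z ∈ E', ‖F z‖ ≤ 1 := fun z hz => by
    rw [hnF, div_le_one hB]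
    exact hfB _ hz
  have hlog : 0 < Real.log (A / B) := Real.log_pos hAB1
  have hF0' : 0 < ‖F 0‖ := norm_pos_iff.2 hF0
  have hle : volume E' ≤ _ := volume_le_of_volume_angle_le hE'm hR.le hE'R fun r hr hrR =>
    volume_angle_le hFd hr hF0 hAB1 hE'm (fun z hz => hFA z (hz.trans_le hrR)) hFE
  set θ := volume.real E / (Real.pi * R ^ 2) with hθ
  have hquot : 0 ≤ Real.log (A / B / ‖F 0‖) :=
    Real.log_nonneg ((one_le_div hF0').2 (hFA 0 (by simpa using hR.le)))
  have hreal : volume.real E ≤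
      R ^ 2 / 2 * (2 * Real.pi * (Real.log (A / B / ‖F 0‖) / Real.log (A / B))) := by
    rw [Measure.real, ← hvol]
    exact ENNReal.toReal_le_of_le_ofReal (by positivity) hle
  have hθle : θ * Real.log (A / B) ≤ Real.log (A / B) - Real.log ‖F 0‖ := by
    rw [← Real.log_div (by positivity) hF0'.ne', ← le_div_iff₀ hlog, hθ,
      div_le_iff₀ (by positivity)]
    linarith
  have hfc : ‖f c‖ = B * ‖F 0‖ := by
    rw [hnF, add_zero]
    field_simp
  have hBA : Real.log (B / A) = -Real.log (A / B) := by rw [← Real.log_inv, inv_div]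
  have hA' : A = B * Real.exp (Real.log (A / B)) := by
    rw [Real.exp_log (by positivity)]
    field_simp
  calc ‖f c‖ = B * Real.exp (Real.log ‖F 0‖) := by rw [hfc, Real.exp_log hF0']
    _ ≤ B * Real.exp (Real.log (A / B) + Real.log (B / A) * θ) := by
        gcongr
        rw [hBA]
        linarith
    _ = B * Real.exp (Real.log (A / B)) * (B / A) ^ θ := by
        rw [Real.exp_add, Real.rpow_def_of_pos (by positivity), mul_assoc]
    _ = A * (B / A) ^ θ := by rw [← hA']


/-! ### Growth, maximum modulus and type. -/

/-- `f` has growth at most `exp (σ * |z - c| ^ ρ)`, up to a constant factor. -/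
def HasGrowth (f : ℂ → ℂ) (ρ σ : ℝ) (c : ℂ) : Prop :=
  ∃ C : ℝ, 0 ≤ C ∧ ∀ z, ‖f z‖ ≤ C * Real.exp (σ * ‖z - c‖ ^ ρ)

lemma HasGrowth.change_center {f : ℂ → ℂ} {ρ σ σ' : ℝ} {c : ℂ} (h : HasGrowth f ρ σ c)
    (hρ : 0 < ρ) (hσ : 0 ≤ σ) (hσσ' : σ < σ') (c' : ℂ) : HasGrowth f ρ σ' c' := by
  obtain ⟨C, hC, hf⟩ := h
  obtain ⟨D, hD, hexp⟩ := exists_exp_le_mul_exp hρ hσ hσσ' (norm_nonneg (c' - c))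
  refine ⟨C * D, by positivity, fun z => (hf z).trans ?_⟩
  rw [mul_assoc]
  gcongr
  refine le_trans ?_ (hexp _ (norm_nonneg (z - c')))
  gcongr
  calc ‖z - c‖ = ‖(z - c') + (c' - c)‖ := by ring_nf
    _ ≤ _ := norm_add_le _ _

section MaxModulus

variable {g : ℂ → ℂ}

lemma norm_le_maxModulus (hg : Continuous g) {r : ℝ} {z : ℂ} (hz : ‖z‖ ≤ r) :
    ‖g z‖ ≤ maxModulus g r := by
  refine le_csSup ?_ ⟨z, by simpa using hz, rfl⟩
  exact ((isCompact_closedBall 0 r).image hg.norm).bddAbove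

lemma maxModulus_le {r B : ℝ} (hr : 0 ≤ r) (h : ∀ z, ‖z‖ ≤ r → ‖g z‖ ≤ B) :
    maxModulus g r ≤ B := by
  refine csSup_le ((Metric.nonempty_closedBall.2 hr).image _) ?_
  rintro _ ⟨z, hz, rfl⟩
  exact h z (by simpa using hz)

lemma maxModulus_nonneg (g : ℂ → ℂ) (r : ℝ) : 0 ≤ maxModulus g r := by
  refine Real.sSup_nonneg ?_
  rintro _ ⟨z, -, rfl⟩
  exact norm_nonneg _

lemma type_le_of_hasGrowth {σ : ℝ} (hρ : 0 < rho g) (hσ : 0 ≤ σ)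
    (h : HasGrowth g (rho g) σ 0) : type g ≤ (σ : EReal) := by
  obtain ⟨C, hC, hf⟩ := h
  set D := max C 1
  have hD : 1 ≤ D := le_max_right _ _
  have hlim : Tendsto (fun r : ℝ => ((Real.log D / r ^ rho g + σ : ℝ) : EReal)) atTop
      (𝓝 (σ : EReal)) := by
    refine (continuous_coe_real_ereal.tendsto _).comp ?_
    have := (tendsto_const_nhds (x := Real.log D)).div_atTop (tendsto_rpow_atTop hρ)
    simpa using this.add_const σ
  rw [← hlim.limsup_eq]
  refine limsup_le_limsup ?_
  filter_upwards [eventually_gt_atTop 0] with r hr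
  rw [EReal.coe_le_coe_iff]
  have hp : 0 < r ^ rho g := Real.rpow_pos_of_pos hr _
  rw [div_add' _ _ _ hp.ne', div_le_div_iff_of_pos_right hp]
  have hM : maxModulus g r ≤ D * Real.exp (σ * r ^ rho g) := by
    refine maxModulus_le hr.le fun z hz => (hf z).trans ?_
    rw [sub_zero]
    gcongr
    exact le_max_left _ _
  rcases (maxModulus_nonneg g r).eq_or_lt with h0 | h0
  · rw [← h0, Real.log_zero]
    have := Real.log_nonneg hD
    positivity
  · refine (Real.log_le_log h0 hM).trans ?_
    rw [Real.log_mul (by positivity) (Real.exp_ne_zero _), Real.log_exp]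

lemma hasGrowth_of_type_lt (hg : Continuous g) {σ : ℝ} (hσ : 0 ≤ σ)
    (h : type g < (σ : EReal)) : HasGrowth g (rho g) σ 0 := by
  have h1 := eventually_lt_of_limsup_lt h
  obtain ⟨r₀, h2⟩ := eventually_atTop.1 (h1.and (eventually_gt_atTop 0))
  refine ⟨max 1 (maxModulus g r₀), by positivity, fun z => ?_⟩
  rw [sub_zero]
  rcases le_total r₀ ‖z‖ with hz | hz
  · obtain ⟨h3, h4⟩ := h2 _ hz
    rw [EReal.coe_lt_coe_iff, div_lt_iff₀ (Real.rpow_pos_of_pos h4 _)] at h3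
    have h5 : maxModulus g ‖z‖ ≤ Real.exp (σ * ‖z‖ ^ rho g) := by
      rcases (maxModulus_nonneg g ‖z‖).eq_or_lt with h0 | h0
      · rw [← h0]; positivity
      · exact ((Real.log_lt_iff_lt_exp h0).1 h3).le
    exact (norm_le_maxModulus hg le_rfl).trans
      (h5.trans (le_mul_of_one_le_left (Real.exp_pos _).le (le_max_left _ _)))
  · refine ((norm_le_maxModulus hg hz).trans (le_max_right 1 _)).trans ?_
    exact le_mul_of_one_le_right (by positivity) (Real.one_le_exp (by positivity))

/-- If `|g| ≤ 1` everywhere, Liouville makes `g` constant, hence of order `0`. Otherwise `M(r) ≥ 1`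
for large `r`. -/
lemma type_nonneg (hg : Differentiable ℂ g) (hpos : 0 < order g) : 0 ≤ type g := by
  have hub : ∃ z, 1 < ‖g z‖ := by
    by_contra! hb
    have hconst : ∀ z, g z = g 0 := fun z =>
      hg.apply_eq_apply_of_bounded (isBounded_iff_forall_norm_le.2
        ⟨1, by rintro _ ⟨z, rfl⟩; exact hb z⟩) z 0
    have hM : ∀ᶠ r : ℝ in atTop, maxModulus g r = ‖g 0‖ := by
      filter_upwards [eventually_ge_atTop 0] with r hr
      refine le_antisymm (maxModulus_le hr fun z _ => by rw [hconst z]) ?_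
      exact norm_le_maxModulus hg.continuous (by simpa using hr)
    have hlim : Tendsto (fun r : ℝ =>
        ((Real.log (Real.log (maxModulus g r)) / Real.log r : ℝ) : EReal)) atTop
        (𝓝 ((0 : ℝ) : EReal)) := by
      refine (continuous_coe_real_ereal.tendsto _).comp ?_
      have := (tendsto_const_nhds (x := Real.log (Real.log ‖g 0‖))).div_atTop
        Real.tendsto_log_atTop
      refine this.congr' ?_
      filter_upwards [hM] with r hr
      rw [hr]
    rw [order, hlim.limsup_eq] at hpos
    simp at hpos
  obtain ⟨z, hz⟩ := hub
  refine le_limsup_of_frequently_le (Eventually.frequently ?_)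
  filter_upwards [eventually_ge_atTop ‖z‖, eventually_gt_atTop 0] with r hr hr0
  have h1 : 1 ≤ maxModulus g r := hz.le.trans (norm_le_maxModulus hg.continuous hr)
  have := Real.log_nonneg h1
  exact_mod_cast (by positivity : 0 ≤ Real.log (maxModulus g r) / r ^ rho g)

lemma rho_pos (hpos : 0 < order g) (hfin : order g < ⊤) : 0 < rho g :=
  EReal.toReal_pos hpos hfin.ne

end MaxModulus

/-! ### Taylor coefficients and growth. -/

section Coeff

variable {g : ℂ → ℂ}

lemma differentiable_coeff (hg : Differentiable ℂ g) (n : ℕ) : Differentiable ℂ (coeff g n) := by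
  have h := (hg.contDiff (n := ((n + 1 : ℕ) : WithTop ℕ∞))).differentiable_iteratedDeriv n
    (by exact_mod_cast Nat.lt_succ_self n)
  exact h.div_const _

lemma norm_coeff_le (hg : Differentiable ℂ g) (n : ℕ) {z : ℂ} {r C : ℝ} (hr : 0 < r)
    (h : ∀ w ∈ Metric.sphere z r, ‖g w‖ ≤ C) : ‖coeff g n z‖ ≤ C / r ^ n := by
  have h1 := Complex.norm_iteratedDeriv_le_of_forall_mem_sphere_norm_le n hr
    hg.diffContOnCl h
  rw [coeff, norm_div, Complex.norm_natCast, div_le_iff₀ (by positivity)]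
  refine h1.trans_eq ?_
  ring

/-- The bridge between the parities: `aₙ₊₁ = aₙ' / (n + 1)`, and the factor `1 / (n + 1)` is simply
dropped. -/
lemma norm_coeff_succ_le (hg : Differentiable ℂ g) (n : ℕ) {z : ℂ} {r C : ℝ} (hr : 0 < r)
    (h : ∀ w ∈ Metric.sphere z r, ‖coeff g n w‖ ≤ C) : ‖coeff g (n + 1) z‖ ≤ C / r := by
  have h1 := Complex.norm_deriv_le_of_forall_mem_sphere_norm_le hr
    (differentiable_coeff hg n).diffContOnCl h
  have h2 : coeff g (n + 1) z = deriv (coeff g n) z / ((n + 1 : ℕ) : ℂ) := by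
    have : coeff g n = fun z => iteratedDeriv n g z / (n.factorial : ℂ) := rfl
    rw [this, deriv_div_const, ← iteratedDeriv_succ, coeff, Nat.factorial_succ, div_div]
    push_cast
    rw [mul_comm]
  rw [h2, norm_div, Complex.norm_natCast]
  refine (div_le_self (norm_nonneg _) ?_).trans h1
  exact_mod_cast Nat.succ_le_succ n.zero_le

/-- An entire function whose Taylor coefficients satisfy `|aₙ| rⁿ ≤ C exp (σ r ^ ρ)` has growth
at most `exp (σ' |z| ^ ρ)` for all `σ' > σ`. -/
lemma hasGrowth_of_norm_coeff_mul_pow_le (hg : Differentiable ℂ g) {ρ σ σ' C : ℝ} (hρ : 0 < ρ)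
    (hσ : 0 < σ) (hσσ' : σ < σ') (hC : 0 ≤ C) {c : ℂ}
    (h : ∀ n r, 0 ≤ r → ‖coeff g n c‖ * r ^ n ≤ C * Real.exp (σ * r ^ ρ)) :
    HasGrowth g ρ σ' c := by
  -- With `σ q ^ ρ = σ'`, the hypothesis at radius `q |z - c|` bounds the `n`-th Taylor term by `q⁻¹
  -- ^ n` times the target, which is summable.
  set q := (σ' / σ) ^ (ρ⁻¹) with hq
  have hσ'0 : 0 < σ' := hσ.trans hσσ'
  have hq1 : 1 < q := Real.one_lt_rpow ((one_lt_div hσ).2 hσσ') (by positivity)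
  have hq0 : 0 < q := one_pos.trans hq1
  have hqρ : σ * q ^ ρ = σ' := by
    rw [hq, Real.rpow_inv_rpow (by positivity) hρ.ne']
    field_simp
  refine ⟨C * (1 - q⁻¹)⁻¹, mul_nonneg hC
    (inv_nonneg.2 (sub_nonneg.2 (inv_le_one_of_one_le₀ hq1.le))), fun z => ?_⟩
  have hsum := Complex.taylorSeries_eq_of_entire' (c := c) (z := z) hg
  rw [← hsum]
  have hgeo := (hasSum_geometric_of_lt_one (inv_nonneg.2 hq0.le)
    (inv_lt_one_of_one_lt₀ hq1)).mul_left (C * Real.exp (σ' * ‖z - c‖ ^ ρ))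
  refine (tsum_of_norm_bounded hgeo fun n => ?_).trans_eq (by ring)
  have h1 := h n (q * ‖z - c‖) (by positivity)
  rw [Real.mul_rpow hq0.le (norm_nonneg _), ← mul_assoc, hqρ, mul_pow] at h1
  have h2 : ‖((n.factorial : ℂ))⁻¹ * iteratedDeriv n g c * (z - c) ^ n‖ =
      ‖coeff g n c‖ * (q ^ n * ‖z - c‖ ^ n) * q⁻¹ ^ n := by
    have h3 : q ^ n * q⁻¹ ^ n = 1 := by rw [← mul_pow, mul_inv_cancel₀ hq0.ne', one_pow]
    calc _ = ‖coeff g n c‖ * ‖z - c‖ ^ n * 1 := by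
          rw [norm_mul, norm_pow, coeff, mul_one, inv_mul_eq_div]
      _ = _ := by rw [← h3]; ring
  rw [h2]
  gcongr

/-- The scaled coefficient `n |aₙ(z)| ^ (ρ / n)` whose upper limit determines the type. -/
def scaledCoeff (g : ℂ → ℂ) (ρ : ℝ) (n : ℕ) (z : ℂ) : ℝ := (n : ℝ) * ‖coeff g n z‖ ^ (ρ / n)

lemma scaledCoeff_nonneg (g : ℂ → ℂ) (ρ : ℝ) (n : ℕ) (z : ℂ) : 0 ≤ scaledCoeff g ρ n z := by
  unfold scaledCoeff
  positivity

lemma continuous_scaledCoeff (hg : Differentiable ℂ g) {ρ : ℝ} (hρ : 0 < ρ) (n : ℕ) :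
    Continuous (scaledCoeff g ρ n) :=
  ((differentiable_coeff hg n).continuous.norm.rpow_const fun _ => Or.inr (by positivity)).const_mul
    (n : ℝ)

lemma scaledCoeff_le_iff {ρ s : ℝ} (hρ : 0 < ρ) (hs : 0 ≤ s) {n : ℕ} (hn : n ≠ 0) {z : ℂ} :
    scaledCoeff g ρ n z ≤ s ↔ ‖coeff g n z‖ ≤ (s / n) ^ ((n : ℝ) / ρ) :=
  natCast_mul_rpow_le_iff hn hρ (norm_nonneg _) hs

/-- Upper bound for the scaled coefficients of a function of finite type, locally uniform in the
base point. -/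
lemma HasGrowth.eventually_scaledCoeff_le (hg : Differentiable ℂ g) {ρ σ σ' : ℝ} (hρ : 0 < ρ)
    (hσ : 0 ≤ σ) (hσσ' : σ < σ') (h : HasGrowth g ρ σ 0) (R : ℝ) :
    ∀ᶠ n : ℕ in atTop, ∀ z : ℂ, ‖z‖ ≤ R → scaledCoeff g ρ n z ≤ Real.exp 1 * ρ * σ' := by
  obtain ⟨C, hC, hf⟩ := h
  have hσ'0 : 0 < σ' := hσ.trans_lt hσσ'
  have hr : Tendsto (fun n : ℕ => ((n : ℝ) / (ρ * σ')) ^ ρ⁻¹) atTop atTop :=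
    (tendsto_rpow_atTop (inv_pos.2 hρ)).comp
      (tendsto_natCast_atTop_atTop.atTop_div_const (by positivity))
  filter_upwards [hr.eventually (eventually_mul_exp_le_exp hρ hσσ' C R), eventually_ne_atTop 0]
    with n hn hn0 z hz
  -- The optimal Cauchy radius, minimising `exp (σ' r ^ ρ) / r ^ n`.
  set r := ((n : ℝ) / (ρ * σ')) ^ ρ⁻¹ with hrdef
  have hn' : (0 : ℝ) < n := by positivity
  have hr0 : 0 < r := by positivity
  have hrρ : r ^ ρ = n / (ρ * σ') := Real.rpow_inv_rpow (by positivity) hρ.ne'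
  rw [scaledCoeff_le_iff hρ (by positivity) hn0]
  have h1 : ‖coeff g n z‖ ≤ Real.exp (σ' * r ^ ρ) / r ^ n := by
    refine norm_coeff_le hg n hr0 fun w hw => ((hf w).trans ?_).trans hn
    rw [sub_zero]
    gcongr
    rw [mem_sphere_iff_norm] at hw
    calc ‖w‖ = ‖(w - z) + z‖ := by ring_nf
      _ ≤ ‖w - z‖ + ‖z‖ := norm_add_le _ _
      _ ≤ r + R := by rw [hw]; gcongr
  refine h1.trans_eq ?_
  have h2 : r ^ n = (n / (ρ * σ')) ^ ((n : ℝ) / ρ) := by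
    rw [← hrρ, ← Real.rpow_mul hr0.le, mul_div_cancel₀ _ hρ.ne', Real.rpow_natCast]
  have h3 : Real.exp (σ' * r ^ ρ) = Real.exp 1 ^ ((n : ℝ) / ρ) := by
    rw [← Real.exp_mul, hrρ]
    congr 1
    field_simp
  rw [h2, h3, ← Real.div_rpow (by positivity) (by positivity)]
  congr 1
  field_simp

/-- A locally uniform bound on the scaled coefficients of one parity bounds the growth. -/
theorem hasGrowth_of_scaledCoeff_le (hg : Differentiable ℂ g) {ρ σ σ' : ℝ} (hρ : 0 < ρ)
    (hσ : 0 < σ) (hσσ' : σ < σ') {c : ℂ} {s : ℝ} (hs : 0 < s) {p K : ℕ} (hp : p ≤ 1)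
    (h : ∀ k, K ≤ k → ∀ z ∈ Metric.closedBall c s,
      scaledCoeff g ρ (2 * k + p) z ≤ Real.exp 1 * ρ * σ) :
    HasGrowth g ρ σ' c := by
  obtain ⟨σ₁, h1, h2⟩ := exists_between hσσ'
  have hσ₁ : 0 < σ₁ := hσ.trans h1
  have hpar : ∀ k, K ≤ k → k ≠ 0 → ∀ z ∈ Metric.closedBall c s, ∀ r, 0 ≤ r →
      ‖coeff g (2 * k + p) z‖ * r ^ (2 * k + p) ≤ Real.exp (σ * r ^ ρ) := by
    intro k hk hk0 z hz r hr
    have hn : 2 * k + p ≠ 0 := by omega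
    refine le_trans ?_ (rpow_mul_pow_le_exp hn hρ hσ.le hr)
    gcongr
    exact (scaledCoeff_le_iff hρ (by positivity) hn).1 (h k hk z hz)
  -- The `1` serves the given parity and `r / s` the other one, estimated on a circle of fixed
  -- radius `s`. The offset `4` leaves room for `k ≥ K` and `k ≠ 0`.
  have hlarge : ∀ n, 2 * K + 4 ≤ n → ∀ r, 0 ≤ r →
      ‖coeff g n c‖ * r ^ n ≤ (1 + r / s) * Real.exp (σ * r ^ ρ) := by
    intro n hn r hr
    obtain ⟨k, hk, hk0, hnk⟩ : ∃ k, K ≤ k ∧ k ≠ 0 ∧ (n = 2 * k + p ∨ n = 2 * k + p + 1) :=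
      ⟨(n - p) / 2, by omega, by omega, by omega⟩
    rw [add_mul, one_mul]
    rcases hnk with rfl | rfl
    · refine (hpar k hk hk0 c (Metric.mem_closedBall_self hs.le) r hr).trans ?_
      exact le_add_of_nonneg_right (by positivity)
    · refine le_add_of_nonneg_of_le (by positivity) ?_
      rcases hr.eq_or_lt with rfl | hr0
      · simp
      have h3 : ‖coeff g (2 * k + p + 1) c‖ ≤
          Real.exp (σ * r ^ ρ) / r ^ (2 * k + p) / s := by
        refine norm_coeff_succ_le hg _ hs fun w hw => ?_
        rw [le_div_iff₀ (by positivity)]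
        exact hpar k hk hk0 w (Metric.sphere_subset_closedBall hw) r hr
      calc _ ≤ Real.exp (σ * r ^ ρ) / r ^ (2 * k + p) / s * r ^ (2 * k + p + 1) := by gcongr
        _ = _ := by
          rw [pow_succ]
          field_simp
  -- The gap from `σ` to `σ₁` absorbs the factor `1 + r / s`; the finitely many small indices go
  -- into `S`.
  obtain ⟨D, hD, hDr⟩ := pow_le_mul_exp 1 hρ (sub_pos.2 h1)
  choose A hA hAr using fun n => pow_le_mul_exp n hρ hσ₁
  set S := ∑ n ∈ Finset.range (2 * K + 4), ‖coeff g n c‖ * A n with hS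
  have hterm : ∀ n, 0 ≤ ‖coeff g n c‖ * A n := fun n => mul_nonneg (norm_nonneg _) (hA n)
  have hS0 : 0 ≤ S := Finset.sum_nonneg fun n _ => hterm n
  refine hasGrowth_of_norm_coeff_mul_pow_le hg hρ hσ₁ h2 (C := S + (1 + D / s))
    (by positivity) fun n r hr => ?_
  rw [add_mul]
  rcases lt_or_ge n (2 * K + 4) with hn | hn
  · refine le_add_of_le_of_nonneg ?_ (by positivity)
    calc ‖coeff g n c‖ * r ^ n ≤ ‖coeff g n c‖ * (A n * Real.exp (σ₁ * r ^ ρ)) := by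
          gcongr
          exact hAr n r hr
      _ = ‖coeff g n c‖ * A n * Real.exp (σ₁ * r ^ ρ) := by ring
      _ ≤ S * Real.exp (σ₁ * r ^ ρ) := by
          gcongr
          exact Finset.single_le_sum (f := fun n => ‖coeff g n c‖ * A n)
            (fun n _ => hterm n) (Finset.mem_range.2 hn)
  · refine le_add_of_nonneg_of_le (by positivity) ((hlarge n hn r hr).trans ?_)
    have h3 := hDr r hr
    rw [pow_one] at h3
    have h4 : 1 ≤ Real.exp ((σ₁ - σ) * r ^ ρ) :=
      Real.one_le_exp (mul_nonneg (sub_pos.2 h1).le (by positivity))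
    calc (1 + r / s) * Real.exp (σ * r ^ ρ)
        ≤ (Real.exp ((σ₁ - σ) * r ^ ρ) + D * Real.exp ((σ₁ - σ) * r ^ ρ) / s) *
          Real.exp (σ * r ^ ρ) := by gcongr
      _ = (1 + D / s) * (Real.exp ((σ₁ - σ) * r ^ ρ) * Real.exp (σ * r ^ ρ)) := by ring
      _ = _ := by
          rw [← Real.exp_add]
          ring_nf

end Coeff


/-! ### The two parities treated together. -/

variable {g : ℂ → ℂ}

/-- The common form of `tauEven` (`p = 0`) and `tauOdd` (`p = 1`). -/
def tauParity (p : ℕ) (g : ℂ → ℂ) (z : ℂ) : EReal :=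
  ((1 / (Real.exp 1 * rho g) : ℝ) : EReal) *
    limsup (fun k : ℕ => ((scaledCoeff g (rho g) (2 * k + p) z : ℝ) : EReal)) atTop

lemma tauEven_eq : tauEven g = tauParity 0 g := rfl

lemma tauOdd_eq : tauOdd g = tauParity 1 g := rfl

lemma limsup_scaledCoeff_nonneg (p : ℕ) (z : ℂ) :
    0 ≤ limsup (fun k : ℕ => ((scaledCoeff g (rho g) (2 * k + p) z : ℝ) : EReal)) atTop :=
  le_limsup_of_frequently_le
    (Frequently.of_forall fun _ => EReal.coe_nonneg.2 (scaledCoeff_nonneg _ _ _ _))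

lemma tauParity_nonneg (hρ : 0 < rho g) (p : ℕ) (z : ℂ) : 0 ≤ tauParity p g z :=
  mul_nonneg (EReal.coe_nonneg.2 (by positivity)) (limsup_scaledCoeff_nonneg p z)

lemma tauParity_le (hρ : 0 < rho g) {p : ℕ} {z : ℂ} {σ : ℝ}
    (h : ∀ᶠ k : ℕ in atTop, scaledCoeff g (rho g) (2 * k + p) z ≤ Real.exp 1 * rho g * σ) :
    tauParity p g z ≤ (σ : EReal) := by
  have hle : limsup (fun k : ℕ => ((scaledCoeff g (rho g) (2 * k + p) z : ℝ) : EReal)) atTop ≤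
      ((Real.exp 1 * rho g * σ : ℝ) : EReal) :=
    limsup_le_of_le (h := h.mono fun k hk => EReal.coe_le_coe_iff.2 hk)
  refine (mul_le_mul_of_nonneg_left hle (EReal.coe_nonneg.2 (by positivity))).trans_eq ?_
  rw [← EReal.coe_mul]
  congr 1
  field_simp

lemma eventually_scaledCoeff_le_of_tauParity_lt (hρ : 0 < rho g) {p : ℕ} {z : ℂ} {σ : ℝ}
    (h : tauParity p g z < (σ : EReal)) :
    ∀ᶠ k : ℕ in atTop, scaledCoeff g (rho g) (2 * k + p) z ≤ Real.exp 1 * rho g * σ := by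
  have hlt : limsup (fun k : ℕ => ((scaledCoeff g (rho g) (2 * k + p) z : ℝ) : EReal)) atTop <
      ((Real.exp 1 * rho g * σ : ℝ) : EReal) := by
    by_contra! hle
    refine h.not_ge ?_
    refine le_trans (le_of_eq ?_)
      (mul_le_mul_of_nonneg_left hle (EReal.coe_nonneg.2 (by positivity)))
    rw [← EReal.coe_mul]
    congr 1
    field_simp
  exact (eventually_lt_of_limsup_lt hlt).mono fun k hk => (EReal.coe_lt_coe_iff.1 hk).le

lemma tendsto_two_mul_add_atTop (p : ℕ) : Tendsto (fun k : ℕ => 2 * k + p) atTop atTop :=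
  tendsto_atTop_mono (fun k => by rw [id]; omega) tendsto_id

lemma tauParity_le_type (hg : Differentiable ℂ g) (hρ : 0 < rho g) (h0 : 0 ≤ type g) (p : ℕ)
    (z : ℂ) : tauParity p g z ≤ type g := by
  refine EReal.le_of_forall_lt_iff_le.1 fun σ' hσ' => ?_
  obtain ⟨σ, hσ, hσσ'⟩ := EReal.lt_iff_exists_real_btwn.1 hσ'
  have hσ0 : 0 ≤ σ := by exact_mod_cast h0.trans hσ.le
  have hgr := hasGrowth_of_type_lt hg.continuous hσ0 hσ
  have hev := hgr.eventually_scaledCoeff_le hg hρ hσ0 (EReal.coe_lt_coe_iff.1 hσσ') ‖z‖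
  exact tauParity_le hρ (((tendsto_two_mul_add_atTop p).eventually hev).mono
    fun k hk => hk z le_rfl)

/-! ### Finite type: equality almost everywhere. -/

/-- The two constants theorem for scaled coefficients. -/
lemma scaledCoeff_le_of_le_on (hg : Differentiable ℂ g) {ρ : ℝ} (hρ : 0 < ρ) {n : ℕ}
    (hn : n ≠ 0) {w : ℂ} {R s S : ℝ} (hR : 0 < R) (hs : 0 < s) (hsS : s < S) {E : Set ℂ}
    (hE : MeasurableSet E) (hER : E ⊆ Metric.closedBall w R)
    (hS : ∀ z ∈ Metric.closedBall w R, scaledCoeff g ρ n z ≤ S)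
    (hsE : ∀ z ∈ E, scaledCoeff g ρ n z ≤ s) :
    scaledCoeff g ρ n w ≤ S * (s / S) ^ (volume.real E / (Real.pi * R ^ 2)) := by
  have hS0 : 0 < S := hs.trans hsS
  have hn' : (0 : ℝ) < n := by positivity
  set θ := volume.real E / (Real.pi * R ^ 2)
  rw [scaledCoeff_le_iff hρ (by positivity) hn]
  have hlt : (s / n) ^ ((n : ℝ) / ρ) < (S / n) ^ ((n : ℝ) / ρ) := by
    apply Real.rpow_lt_rpow (by positivity) (by gcongr) (by positivity)
  refine (norm_le_mul_rpow_volume (differentiable_coeff hg n) hR (by positivity) hlt hE hER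
    (fun z hz => (scaledCoeff_le_iff hρ hS0.le hn).1 (hS z hz))
    (fun z hz => (scaledCoeff_le_iff hρ hs.le hn).1 (hsE z hz))).trans_eq ?_
  -- Every constant is a power with exponent `n / ρ`, so the interpolation commutes with the scaling
  -- and loses nothing in `n`.
  rw [← Real.div_rpow (by positivity) (by positivity), ← Real.rpow_mul (by positivity),
    mul_comm _ θ, Real.rpow_mul (by positivity), ← Real.mul_rpow (by positivity) (by positivity)]
  congr 1
  have : s / n / (S / n) = s / S := by field_simp
  rw [this]
  ring

/-- The strict inequality holds at `t' = t` and persists by continuity. The room above `t` is needed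
because coefficients are bounded only by constants exceeding the type. -/
lemma exists_mul_rpow_lt {σ t θ : ℝ} (hσ : 0 < σ) (hσt : σ < t) (hθ : 0 < θ) :
    ∃ t', t < t' ∧ t' * (σ / t') ^ θ < t := by
  have ht : 0 < t := hσ.trans hσt
  have hcont : ContinuousAt (fun x : ℝ => x * (σ / x) ^ θ) t :=
    continuousAt_id.mul ((continuousAt_const.div continuousAt_id ht.ne').rpow_const
      (Or.inr hθ.le))
  have hlt : t * (σ / t) ^ θ < t :=
    mul_lt_of_lt_one_right ht (Real.rpow_lt_one (by positivity) ((div_lt_one ht).2 hσt) hθ)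
  have h1 := (hcont.eventually_lt_const hlt).filter_mono (nhdsWithin_le_nhds (s := Set.Ioi t))
  obtain ⟨t', h2, h3⟩ := (h1.and self_mem_nhdsWithin).exists
  exact ⟨t', h3, h2⟩

/-- The bounded set where the scaled coefficients of one parity are at most `e ρ σ` from the
index `N` on. -/
def boundSet (g : ℂ → ℂ) (p : ℕ) (σ : ℝ) (N : ℕ) : Set ℂ :=
  Metric.closedBall 0 N ∩
    {z | ∀ k, N ≤ k → scaledCoeff g (rho g) (2 * k + p) z ≤ Real.exp 1 * rho g * σ}

lemma isClosed_boundSet (hg : Differentiable ℂ g) (hρ : 0 < rho g) (p : ℕ) (σ : ℝ) (N : ℕ) :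
    IsClosed (boundSet g p σ N) := by
  refine Metric.isClosed_closedBall.inter ?_
  simp only [Set.ofPred_forall]
  exact isClosed_iInter fun k => isClosed_iInter fun _ =>
    isClosed_le (continuous_scaledCoeff hg hρ _) continuous_const

lemma volume_boundSet_eq_zero (hg : Differentiable ℂ g) (hρ : 0 < rho g) {p : ℕ} (hp : p ≤ 1)
    {σ t : ℝ} (hσ : 0 < σ) (hσt : σ < t) (ht : type g = (t : EReal)) (N : ℕ) :
    volume (boundSet g p σ N) = 0 := by
  by_contra hne
  have ht0 : 0 < t := hσ.trans hσt
  set E := boundSet g p σ N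
  have hEball : E ⊆ Metric.closedBall 0 N := Set.inter_subset_left
  have hfin : volume E ≠ ⊤ := measure_ne_top_of_subset hEball
    (isCompact_closedBall _ _).measure_lt_top.ne
  have hvol : 0 < volume.real E := ENNReal.toReal_pos hne hfin
  -- Every disc of radius `N + 1` centred in the closed unit disc contains `E` and lies in the disc
  -- of radius `N + 2`, so one `θ` serves all centres.
  set R : ℝ := N + 1
  have hR : 0 < R := by positivity
  set θ := volume.real E / (Real.pi * R ^ 2)
  have hθ : 0 < θ := by positivity
  obtain ⟨t', htt', hlt⟩ := exists_mul_rpow_lt hσ hσt hθ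
  have ht'0 : 0 < t' := ht0.trans htt'
  obtain ⟨t₁, h1, h2⟩ := exists_between htt'
  have hgr := hasGrowth_of_type_lt hg.continuous (ht0.trans h1).le
    (by rw [ht]; exact_mod_cast h1)
  have hev := hgr.eventually_scaledCoeff_le hg hρ (ht0.trans h1).le h2 (N + 2)
  obtain ⟨K, hK⟩ := eventually_atTop.1 hev
  set s := t' * (σ / t') ^ θ with hs
  have hs0 : 0 < s := by positivity
  obtain ⟨s', hss', hs't⟩ := exists_between hlt
  have hgrow : HasGrowth g (rho g) s' 0 := by
    -- The threshold exceeds `K` and `N`, for the bounds with `t'` and `σ`, and excludes index `0`.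
    refine hasGrowth_of_scaledCoeff_le hg hρ hs0 hss' one_pos hp (K := K + N + 1)
      fun k hk w hw => ?_
    rw [mem_closedBall_zero_iff] at hw
    have hsub : E ⊆ Metric.closedBall w R := fun z hz => by
      have := hEball hz
      rw [mem_closedBall_zero_iff] at this
      rw [mem_closedBall_iff_norm]
      exact (norm_sub_le _ _).trans (add_le_add this hw)
    have hbound := scaledCoeff_le_of_le_on hg hρ (n := 2 * k + p) (by omega) hR
      (s := Real.exp 1 * rho g * σ) (S := Real.exp 1 * rho g * t') (by positivity)
      (by gcongr; exact hσt.trans htt') (isClosed_boundSet hg hρ p σ N).measurableSet hsub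
      (fun z hz => hK _ (by omega) z (by
        rw [mem_closedBall_iff_norm] at hz
        calc ‖z‖ = ‖(z - w) + w‖ := by ring_nf
          _ ≤ ‖z - w‖ + ‖w‖ := norm_add_le _ _
          _ ≤ R + 1 := add_le_add hz hw
          _ = N + 2 := by ring))
      (fun z hz => hz.2 k (by omega))
    refine hbound.trans_eq ?_
    rw [mul_div_mul_left _ _ (by positivity), mul_assoc]
  have := type_le_of_hasGrowth hρ (hs0.trans hss').le hgrow
  rw [ht, EReal.coe_le_coe_iff] at this
  linarith

lemma ae_tauParity_eq_type (hg : Differentiable ℂ g) (hρ : 0 < rho g) (h0 : 0 ≤ type g)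
    (hfin : type g < ⊤) {p : ℕ} (hp : p ≤ 1) :
    ∀ᵐ z ∂(volume : Measure ℂ), tauParity p g z = type g := by
  obtain ⟨t, ht⟩ : ∃ t : ℝ, type g = (t : EReal) :=
    ⟨(type g).toReal, (EReal.coe_toReal hfin.ne (EReal.bot_lt_zero.trans_le h0).ne').symm⟩
  -- Rational `q` keep the union countable. For `t = 0` it is empty.
  have hnull : volume (⋃ (q : ℚ) (_ : 0 < (q : ℝ) ∧ (q : ℝ) < t) (N : ℕ),
      boundSet g p q N) = 0 :=
    measure_iUnion_null fun q => measure_iUnion_null fun hq => measure_iUnion_null fun N =>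
      volume_boundSet_eq_zero hg hρ hp hq.1 hq.2 ht N
  refine measure_mono_null (fun z hz => ?_) hnull
  have hlt : tauParity p g z < type g := lt_of_le_of_ne (tauParity_le_type hg hρ h0 p z) hz
  obtain ⟨a, ha, hat⟩ := EReal.lt_iff_exists_real_btwn.1 hlt
  rw [ht, EReal.coe_lt_coe_iff] at hat
  have ha0 : 0 ≤ a := by exact_mod_cast (tauParity_nonneg hρ p z).trans ha.le
  obtain ⟨q, haq, hqt⟩ := exists_rat_btwn hat
  have hev := eventually_scaledCoeff_le_of_tauParity_lt hρ
    (ha.trans (EReal.coe_lt_coe_iff.2 haq))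
  obtain ⟨K, hK⟩ := eventually_atTop.1 hev
  obtain ⟨M, hM⟩ := exists_nat_ge ‖z‖
  simp only [Set.mem_iUnion]
  -- The one parameter of `boundSet` is both index threshold (`K`) and radius (`M`).
  refine ⟨q, ⟨ha0.trans_lt haq, hqt⟩, max K M, ?_, fun k hk => hK k (le_of_max_le_left hk)⟩
  rw [mem_closedBall_zero_iff]
  exact hM.trans (by exact_mod_cast le_max_right K M)

/-! ### Infinite type: Baire category. -/

/-- The points where infinitely many scaled coefficients of one parity exceed every bound. -/
def unboundedSet (g : ℂ → ℂ) (p : ℕ) : Set ℂ :=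
  ⋂ N : ℕ, {z | ∃ k, N ≤ k ∧ Real.exp 1 * rho g * N < scaledCoeff g (rho g) (2 * k + p) z}

lemma isOpen_setOf_exists_lt_scaledCoeff (hg : Differentiable ℂ g) (hρ : 0 < rho g) (p N : ℕ) :
    IsOpen {z | ∃ k, N ≤ k ∧ Real.exp 1 * rho g * N < scaledCoeff g (rho g) (2 * k + p) z} := by
  simp only [Set.ofPred_exists]
  refine isOpen_iUnion fun k => ?_
  rw [Set.ofPred_and]
  exact isOpen_const.inter (isOpen_lt continuous_const (continuous_scaledCoeff hg hρ _))

lemma isGδ_unboundedSet (hg : Differentiable ℂ g) (hρ : 0 < rho g) (p : ℕ) :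
    IsGδ (unboundedSet g p) :=
  IsGδ.iInter_of_isOpen fun N => isOpen_setOf_exists_lt_scaledCoeff hg hρ p N

/-- A disc missing one of the open sets would carry a uniform bound on one parity, forcing finite
type. -/
lemma dense_unboundedSet (hg : Differentiable ℂ g) (hρ : 0 < rho g) (htop : type g = ⊤) {p : ℕ}
    (hp : p ≤ 1) : Dense (unboundedSet g p) := by
  refine dense_iInter_of_isOpen (fun N => isOpen_setOf_exists_lt_scaledCoeff hg hρ p N)
    fun N => ?_
  refine Metric.dense_iff.2 fun c r hr => ?_
  by_contra hempty
  rw [Set.not_nonempty_iff_eq_empty, Set.eq_empty_iff_forall_notMem] at hempty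
  have hgrow : HasGrowth g (rho g) (N + 2) c := by
    -- `N + 1` rather than `N`, since `σ` must be positive even when `N = 0`.
    refine hasGrowth_of_scaledCoeff_le hg hρ (σ := N + 1) (by positivity) (by linarith)
      (half_pos hr) hp (K := N) fun k hk z hz => ?_
    have h1 : ¬ Real.exp 1 * rho g * N < scaledCoeff g (rho g) (2 * k + p) z := fun h =>
      hempty z ⟨Metric.closedBall_subset_ball (half_lt_self hr) hz, k, hk, h⟩
    refine (not_lt.1 h1).trans ?_
    gcongr
    linarith
  have h2 := type_le_of_hasGrowth hρ (by positivity)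
    (hgrow.change_center hρ (by positivity) (lt_add_one _) 0)
  rw [htop] at h2
  exact (EReal.coe_lt_top _).not_ge h2

lemma tauParity_eq_top (hρ : 0 < rho g) {p : ℕ} {z : ℂ} (hz : z ∈ unboundedSet g p) :
    tauParity p g z = ⊤ := by
  refine EReal.eq_top_iff_forall_lt _ |>.2 fun a => ?_
  by_contra! hle
  have hev := eventually_scaledCoeff_le_of_tauParity_lt hρ
    (hle.trans_lt (EReal.coe_lt_coe_iff.2 (lt_add_one a)))
  obtain ⟨K, hK⟩ := eventually_atTop.1 hev
  obtain ⟨M, hM⟩ := exists_nat_ge (a + 1)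
  obtain ⟨k, hk, hlt⟩ := Set.mem_iInter.1 hz (max K M)
  refine hlt.not_ge ((hK k (le_of_max_le_left hk)).trans ?_)
  gcongr
  exact hM.trans (by exact_mod_cast le_max_right K M)

/-- The complement of a countable set is itself a dense Gδ, so by Baire it meets `U`. -/
lemma not_countable_of_isGδ_of_dense {U : Set ℂ} (hU : IsGδ U) (hd : Dense U) :
    ¬ U.Countable := fun hc => by
  obtain ⟨z, hz, hz'⟩ :=
    (hd.inter_of_Gδ hU hc.isGδ_compl (hc.dense_compl ℝ)).nonempty
  exact hz' hz

end EntireType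

end

theorem theorem2 (g : ℂ → ℂ) (hg : Differentiable ℂ g)
    (hpos : 0 < EntireType.order g) (hfin : EntireType.order g < ⊤) :
    (EntireType.type g < ⊤ →
      ∀ᵐ z ∂(volume : Measure ℂ),
        EntireType.tauEven g z = EntireType.type g ∧
          EntireType.tauOdd g z = EntireType.type g) ∧
    (EntireType.type g = ⊤ →
      ∃ U : Set ℂ, IsGδ U ∧ Dense U ∧ ¬ U.Countable ∧
        ∀ z ∈ U, EntireType.tauEven g z = ⊤ ∧ EntireType.tauOdd g z = ⊤) := by
  have hρ := EntireType.rho_pos hpos hfin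
  have h0 := EntireType.type_nonneg hg hpos
  rw [EntireType.tauEven_eq, EntireType.tauOdd_eq]
  refine ⟨fun htype => ?_, fun htype => ?_⟩
  · exact (EntireType.ae_tauParity_eq_type hg hρ h0 htype zero_le_one).and
      (EntireType.ae_tauParity_eq_type hg hρ h0 htype le_rfl)
  · have hG0 := EntireType.isGδ_unboundedSet hg hρ 0
    have hG1 := EntireType.isGδ_unboundedSet hg hρ 1
    have hd := (EntireType.dense_unboundedSet hg hρ htype zero_le_one).inter_of_Gδ hG0 hG1
      (EntireType.dense_unboundedSet hg hρ htype le_rfl)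
    exact ⟨_, hG0.inter hG1, hd,
      EntireType.not_countable_of_isGδ_of_dense (hG0.inter hG1) hd,
      fun z hz => ⟨EntireType.tauParity_eq_top hρ hz.1, EntireType.tauParity_eq_top hρ hz.2⟩⟩
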